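/- For a bounded real sequence $x=(x(n))_{n\in\omega}\in\ell_\infty$, let $\mathrm{L}_x$ be the set of its accumulation points, i.e. of those $\eta\in\mathbb{R}$ such that $\{n\in\omega : |x(n)-\eta|<\varepsilon\}$ is infinite for every $\varepsilon>0$. For a cardinal $\kappa$ let $\mathrm{L}(\kappa)=\{x\in\ell_\infty : |\mathrm{L}_x|=\kappa\}$. A subset $M$ of a vector space is called $\kappa$-lineable if $M\cup\{0\}$ contains a linear subspace of dimension $\kappa$. For a non-empty set $A\subseteq\omega$ with $\min A\ge 2$ put \[ \ell(A)=\sup\Bigl\{m\in\omega : \bigcup_{n\in A}\mathrm{L}(n)\ \text{is } m\text{-lineable}\Bigr\}\in\omega\cup\{\infty\}. \] Let $A\subseteq\omega$ be a non-empty finite set with $\min A\ge 2$, and let $k\in\omega$ satisfy $k>2\max A$. Then $\ell(A\cup\{k\})=\ell(A)$. -/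

import Mathlib

namespace AccLineability

open scoped ENNReal

/-- The set of accumulation points of a bounded real sequence `x`: the reals `η` such that
`{n | |x n - η| < ε}` is infinite for every `ε > 0`. -/
def accPoints (x : lp (fun _ : ℕ => ℝ) ∞) : Set ℝ :=
  {η : ℝ | ∀ ε : ℝ, 0 < ε → {n : ℕ | |x n - η| < ε}.Infinite}

/-- `L κ` is the set of all bounded real sequences with exactly `κ` accumulation points. -/
def L (κ : Cardinal.{0}) : Set (lp (fun _ : ℕ => ℝ) ∞) :=
  {x | Cardinal.mk (accPoints x) = κ}

/-- A subset `M` of a real vector space is `κ`-lineable if `M ∪ {0}` contains a linear subspace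
of (algebraic) dimension `κ`. -/
def IsLineable {X : Type*} [AddCommGroup X] [Module ℝ X] (κ : Cardinal) (M : Set X) : Prop :=
  ∃ V : Submodule ℝ X, Module.rank ℝ V = κ ∧ (V : Set X) ⊆ M ∪ {0}

/-- `ell A` is the supremum (possibly `∞`) of the `m : ℕ` such that `⋃ n ∈ A, L n` is
`m`-lineable. -/
noncomputable def ell (A : Set ℕ) : ℕ∞ :=
  sSup {e : ℕ∞ | ∃ m : ℕ, e = (m : ℕ∞) ∧ IsLineable (m : Cardinal) (⋃ n ∈ A, L (n : Cardinal))}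

end AccLineability


/-!
Let `x` and `y` be linearly independent with all nonzero combinations in `⋃ n ∈ A ∪ {k}, L n`.
The accumulation points of `a • x + b • y` are the values of the functional `(a, b)` on the finite
set `K ⊆ ℝ × ℝ` of cluster points of `n ↦ (x n, y n)`. A generic functional is injective on `K`, so
if `x` has `k` accumulation points then `K` has exactly `k` points. On the other hand there are two
functionals, neither of them injective on `K`, that never vary in opposite directions on `K`: they
embed `K` as a chain in the product of their two sets of values, so these sets have together at
least `k + 1` elements. Not being injective, neither functional takes `k` values, so each takes at
most `k / 2`, a contradiction. Hence a subspace containing a nonzero element of `L k` is a line, and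
lines occur already for `A` alone.
-/

namespace AccLineability

open Filter Finset Topology
open scoped ENNReal

section Pencil

variable {ι 𝕜 : Type*}

theorem card_add_one_le_of_monovaryOn {α β : Type*} [LinearOrder α] [LinearOrder β]
    {s : Finset ι} (hs : s.Nonempty) {f : ι → α} {g : ι → β} (hfg : MonovaryOn f g s)
    (hinj : Set.InjOn (fun i => (f i, g i)) s) :
    #s + 1 ≤ #(s.image f) + #(s.image g) := by
  classical
  induction s using Finset.induction_on_max_value fun i => toLex (f i, g i) with
  | empty => exact absurd hs not_nonempty_empty
  | insert a s has hmax ih =>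
    rcases s.eq_empty_or_nonempty with rfl | hs'
    · simp
    rw [coe_insert] at hfg hinj
    have hsub := Set.subset_insert a (s : Set ι)
    have ih := ih hs' (hfg.subset hsub) (hinj.mono hsub)
    have hlex (i) (hi : i ∈ s) : f i < f a ∨ f i = f a ∧ g i < g a :=
      Prod.Lex.toLex_lt_toLex.1 <| (hmax i hi).lt_of_ne fun h =>
        has (hinj (hsub hi) (Set.mem_insert _ _) h ▸ hi)
    have hnew : f a ∉ s.image f ∨ g a ∉ s.image g := by
      by_contra! h
      obtain ⟨i, hi, hfi⟩ := mem_image.1 h.1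
      obtain ⟨j, hj, hgj⟩ := mem_image.1 h.2
      have hgi : g i < g a := ((hlex i hi).resolve_left hfi.not_lt).2
      have hfj : f j < f a := (hlex j hj).resolve_right fun h => h.2.ne hgj
      exact (hfg (hsub hi) (hsub hj) (hgj ▸ hgi)).not_gt (hfi ▸ hfj)
    have hf := card_le_card (image_subset_image (f := f) (subset_insert a s))
    have hg := card_le_card (image_subset_image (f := g) (subset_insert a s))
    rw [card_insert_of_notMem has]
    rcases hnew with h | h
    · rw [image_insert f, card_insert_of_notMem h]
      omega
    · rw [image_insert g, card_insert_of_notMem h]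
      omega

theorem exists_injOn_add_smul [Field 𝕜] [Infinite 𝕜] {s : Finset ι} {f g : ι → 𝕜}
    (hinj : Set.InjOn (fun i => (f i, g i)) s) : ∃ t : 𝕜, Set.InjOn (f + t • g) s := by
  classical
  obtain ⟨t, ht⟩ := Infinite.exists_notMem_finset
    ((s ×ˢ s).image fun p => (f p.1 - f p.2) / (g p.2 - g p.1))
  refine ⟨t, fun i hi j hj hij => ?_⟩
  simp only [Pi.add_apply, Pi.smul_apply, smul_eq_mul] at hij
  by_cases hg : g i = g j
  · rw [hg, add_left_inj] at hij
    exact hinj hi hj (Prod.ext hij hg)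
  · refine absurd (mem_image.2 ⟨(i, j), mk_mem_product hi hj, ?_⟩) ht
    rw [div_eq_iff (sub_ne_zero.2 (Ne.symm hg))]
    linear_combination hij

variable [Field 𝕜] [LinearOrder 𝕜] [IsStrictOrderedRing 𝕜]

theorem exists_monovaryOn_add_smul_not_injOn {s : Finset ι} (f : ι → 𝕜) {g : ι → 𝕜}
    (hg : (s.image g).Nontrivial) :
    ∃ t : 𝕜, MonovaryOn (f + t • g) g s ∧ ¬ Set.InjOn (f + t • g) s := by
  obtain ⟨_, hgi, _, hgj, hij⟩ := Set.Nontrivial.exists_lt hg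
  obtain ⟨i, hi, rfl⟩ := mem_image.1 hgi
  obtain ⟨j, hj, rfl⟩ := mem_image.1 hgj
  -- The least `t` making `f + t • g` monovary with `g` is the largest of these slopes, and a pair
  -- attaining it takes the same value.
  obtain ⟨⟨p, q⟩, hpq, hmax⟩ := ((s ×ˢ s).filter fun p => g p.1 < g p.2).exists_max_image
    (fun p => (f p.1 - f p.2) / (g p.2 - g p.1))
    ⟨(i, j), mem_filter.2 ⟨mk_mem_product hi hj, hij⟩⟩
  simp only [mem_filter, mem_product, and_imp, Prod.forall] at hpq hmax
  obtain ⟨⟨hp, hq⟩, hlt⟩ := hpq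
  refine ⟨(f p - f q) / (g q - g p), fun r hr u hu hru => ?_, fun h => hlt.ne (congrArg g ?_)⟩
  · have := (div_le_iff₀ (sub_pos.2 hru)).1 (hmax r u hr hu hru)
    simp only [Pi.add_apply, Pi.smul_apply, smul_eq_mul]
    linarith
  · refine h hp hq ?_
    have := (sub_pos.2 hlt).ne'
    simp only [Pi.add_apply, Pi.smul_apply, smul_eq_mul]
    field_simp
    ring

theorem exists_pencil_not_injOn_card_add_one_le {s : Finset ι} {f g : ι → 𝕜}
    (hinj : Set.InjOn (fun i => (f i, g i)) s)
    (hconst : ∀ a b : 𝕜, a ≠ 0 ∨ b ≠ 0 → (s.image (a • f + b • g)).Nontrivial) :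
    ∃ a b c d : 𝕜, (a ≠ 0 ∨ b ≠ 0) ∧ (c ≠ 0 ∨ d ≠ 0) ∧
      ¬ Set.InjOn (a • f + b • g) s ∧ ¬ Set.InjOn (c • f + d • g) s ∧
      #s + 1 ≤ #(s.image (a • f + b • g)) + #(s.image (c • f + d • g)) := by
  have hg : (s.image g).Nontrivial := by simpa using hconst 0 1 (by simp)
  obtain ⟨t, -, ht⟩ := exists_monovaryOn_add_smul_not_injOn f hg
  have hv : (s.image (f + t • g)).Nontrivial := by simpa using hconst 1 t (by simp)
  obtain ⟨r, hmono, hr⟩ := exists_monovaryOn_add_smul_not_injOn g hv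
  have hpair : Set.InjOn (fun i => ((g + r • (f + t • g)) i, (f + t • g) i)) s := by
    intro i hi j hj hij
    simp only [Prod.mk.injEq, Pi.add_apply, Pi.smul_apply, smul_eq_mul] at hij
    have hgij : g i = g j := by linear_combination hij.1 - r * hij.2
    have hfij : f i = f j := by linear_combination hij.2 - t * hgij
    exact hinj hi hj (Prod.ext hfij hgij)
  have hcard := card_add_one_le_of_monovaryOn (image_nonempty.1 hg.nonempty) hmono hpair
  have hu : g + r • (f + t • g) = r • f + (1 + r * t) • g := by
    module
  rw [hu] at hr hcard
  refine ⟨r, 1 + r * t, 1, t, ?_, by simp, hr, by rwa [one_smul], by rwa [one_smul]⟩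
  by_contra! h
  simp [h.1] at h

theorem card_image_ne_of_pencil {A : Set ℕ} {k : ℕ} (hA : ∀ n ∈ A, 2 ≤ n)
    (hAk : ∀ n ∈ A, 2 * n ≤ k) (hk : 2 ≤ k) {s : Finset ι} {f g : ι → 𝕜}
    (hinj : Set.InjOn (fun i => (f i, g i)) s)
    (hcard : ∀ a b : 𝕜, a ≠ 0 ∨ b ≠ 0 → #(s.image (a • f + b • g)) ∈ A ∪ {k}) :
    #(s.image f) ≠ k := by
  intro hf
  have hsk : #s = k := by
    have hle : k ≤ #s := hf ▸ card_image_le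
    obtain ⟨t, ht⟩ := exists_injOn_add_smul hinj
    have hmem := hcard 1 t (by simp)
    rw [one_smul, card_image_of_injOn ht] at hmem
    exact hmem.resolve_left fun h => by linarith [hA _ h, hAk _ h]
  have hmemA (a b : 𝕜) (hab : a ≠ 0 ∨ b ≠ 0) (h : ¬ Set.InjOn (a • f + b • g) s) :
      #(s.image (a • f + b • g)) ∈ A :=
    (hcard a b hab).resolve_right fun hk' => h (card_image_iff.1 (hk'.trans hsk.symm))
  have hconst (a b : 𝕜) (hab : a ≠ 0 ∨ b ≠ 0) : (s.image (a • f + b • g)).Nontrivial := by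
    rw [← one_lt_card_iff_nontrivial]
    rcases hcard a b hab with h | h
    · exact hA _ h
    · exact hk.trans_eq h.symm
  obtain ⟨a, b, c, d, hab, hcd, hab', hcd', hsum⟩ :=
    exists_pencil_not_injOn_card_add_one_le hinj hconst
  linarith [hAk _ (hmemA a b hab hab'), hAk _ (hmemA c d hcd hcd')]

end Pencil

section ClusterPoints

variable {α X Y : Type*} [TopologicalSpace X] [TopologicalSpace Y]

theorem setOf_mapClusterPt_comp [T2Space Y] {l : Filter α} {u : α → X} {K : Set X}
    (hK : IsCompact K) (hu : ∀ᶠ i in l, u i ∈ K) {f : X → Y} (hf : Continuous f) :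
    {y | MapClusterPt y l (f ∘ u)} = f '' {p | MapClusterPt p l u} := by
  refine Set.Subset.antisymm (fun y hy => ?_) ?_
  · obtain ⟨U, hUl, hU⟩ := mapClusterPt_iff_ultrafilter.1 hy
    obtain ⟨p, -, hp⟩ := hK.ultrafilter_le_nhds (U.map u) (tendsto_principal.2 (hu.filter_mono hUl))
    exact ⟨p, mapClusterPt_iff_ultrafilter.2 ⟨U, hUl, hp⟩,
      tendsto_nhds_unique ((hf.tendsto p).comp hp) hU⟩
  · rintro _ ⟨p, hp, rfl⟩
    exact MapClusterPt.continuousAt_comp hf.continuousAt hp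

theorem setOf_mapClusterPt_of_periodic [T1Space X] {u : ℕ → X} {c : ℕ} (hc : c ≠ 0)
    (hu : Function.Periodic u c) : {p | MapClusterPt p atTop u} = Set.range u := by
  refine Set.Subset.antisymm (fun p hp => ?_) ?_
  · have hfin : (Set.range u).Finite := by
      refine ((Set.finite_Iio c).image u).subset ?_
      rintro _ ⟨n, rfl⟩
      exact ⟨n % c, Nat.mod_lt n hc.bot_lt, hu.map_mod_nat n⟩
    exact hfin.isClosed.mem_of_mapClusterPt hp (.of_forall Set.mem_range_self)
  · rintro _ ⟨n, rfl⟩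
    have hφ : Tendsto (fun N => n + N * c) atTop atTop :=
      tendsto_atTop_mono (fun N => (Nat.le_mul_of_pos_right N hc.bot_lt).trans le_add_self)
        tendsto_id
    have hconst : u ∘ (fun N => n + N * c) = fun _ => u n := funext fun N => hu.nat_mul N n
    exact .of_comp hφ (hconst ▸ tendsto_const_nhds.mapClusterPt)

end ClusterPoints

section AccPoints

theorem accPoints_eq_setOf_mapClusterPt (x : lp (fun _ : ℕ => ℝ) ∞) :
    accPoints x = {η | MapClusterPt η atTop x} := by
  ext η
  simp only [accPoints, Set.mem_ofPred_eq, Metric.nhds_basis_ball.mapClusterPt_iff_frequently,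
    Nat.frequently_atTop_iff_infinite, Metric.mem_ball, Real.dist_eq]

theorem accPoints_smul (c : ℝ) (x : lp (fun _ : ℕ => ℝ) ∞) :
    accPoints (c • x) = (c * ·) '' accPoints x := by
  simp only [accPoints_eq_setOf_mapClusterPt]
  exact setOf_mapClusterPt_comp (isCompact_closedBall (0 : ℝ) ‖x‖)
    (.of_forall fun n => mem_closedBall_zero_iff.2 (lp.norm_apply_le_norm ENNReal.top_ne_zero x n))
    (continuous_const_mul c)

/-- The joint accumulation points of two bounded sequences, that is, the cluster points in the plane
of the sequence of pairs. -/
def jointAccPoints (x y : lp (fun _ : ℕ => ℝ) ∞) : Set (ℝ × ℝ) :=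
  {p | MapClusterPt p atTop fun n => (x n, y n)}

theorem accPoints_smul_add_smul (a b : ℝ) (x y : lp (fun _ : ℕ => ℝ) ∞) :
    accPoints (a • x + b • y) = (a • Prod.fst + b • Prod.snd) '' jointAccPoints x y := by
  rw [accPoints_eq_setOf_mapClusterPt]
  refine setOf_mapClusterPt_comp (u := fun n => (x n, y n)) (isCompact_closedBall 0 (max ‖x‖ ‖y‖))
    (.of_forall fun n => mem_closedBall_zero_iff.2 ?_) 
    ((continuous_fst.const_smul a).add (continuous_snd.const_smul b))
  exact max_le_max (lp.norm_apply_le_norm ENNReal.top_ne_zero x n)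
    (lp.norm_apply_le_norm ENNReal.top_ne_zero y n)

theorem finite_jointAccPoints {x y : lp (fun _ : ℕ => ℝ) ∞} (hx : (accPoints x).Finite)
    (hy : (accPoints y).Finite) : (jointAccPoints x y).Finite := by
  rw [accPoints_eq_setOf_mapClusterPt] at hx hy
  exact (hx.prod hy).subset fun p hp =>
    ⟨hp.continuousAt_comp continuousAt_fst, hp.continuousAt_comp continuousAt_snd⟩

theorem mem_iUnion_L_iff {x : lp (fun _ : ℕ => ℝ) ∞} {A : Set ℕ} :
    x ∈ ⋃ n ∈ A, L (n : Cardinal) ↔ (accPoints x).Finite ∧ (accPoints x).ncard ∈ A := by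
  simp only [Set.mem_iUnion, exists_prop, L, Set.mem_ofPred_eq]
  constructor
  · rintro ⟨n, hn, hx⟩
    have hfin : (accPoints x).Finite :=
      Cardinal.lt_aleph0_iff_set_finite.1 (hx ▸ Cardinal.natCast_lt_aleph0)
    rw [← Set.cast_ncard hfin, Nat.cast_inj] at hx
    exact ⟨hfin, hx ▸ hn⟩
  · exact fun ⟨hfin, hn⟩ => ⟨_, hn, (Set.cast_ncard hfin).symm⟩

theorem exists_ncard_accPoints_eq {n : ℕ} (hn : n ≠ 0) :
    ∃ x : lp (fun _ : ℕ => ℝ) ∞, x ≠ 0 ∧ (accPoints x).ncard = n := by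
  let u : ℕ → ℝ := fun i => (i % n + 1 : ℕ)
  have hu : Function.Periodic u n := fun i => by simp [u]
  have hrange : Set.range u = (fun j : ℕ => ((j + 1 : ℕ) : ℝ)) '' Set.Iio n := by
    ext η
    constructor
    · rintro ⟨i, rfl⟩
      exact ⟨i % n, Nat.mod_lt i hn.bot_lt, rfl⟩
    · rintro ⟨j, hj, rfl⟩
      exact ⟨j, by simp only [u, Nat.mod_eq_of_lt hj]⟩
  have hbdd : Memℓp u ∞ := memℓp_infty ⟨(n : ℝ), by
    rintro _ ⟨i, rfl⟩
    simp only [u, Real.norm_natCast, Nat.cast_le]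
    exact Nat.mod_lt i hn.bot_lt⟩
  refine ⟨⟨u, hbdd⟩, fun h => ?_, ?_⟩
  · have h0 : ((0 % n + 1 : ℕ) : ℝ) = 0 := congrArg (fun x : lp (fun _ : ℕ => ℝ) ∞ => x 0) h
    exact Nat.cast_ne_zero.2 (Nat.succ_ne_zero _) h0
  · have hinj : Function.Injective fun j : ℕ => ((j + 1 : ℕ) : ℝ) :=
      (Nat.cast_injective (R := ℝ)).comp (add_left_injective 1)
    rw [accPoints_eq_setOf_mapClusterPt, setOf_mapClusterPt_of_periodic hn hu, hrange,
      Set.ncard_image_of_injective _ hinj, Set.ncard_eq_toFinset_card', Set.toFinset_Iio,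
      Nat.card_Iio]

end AccPoints

section Lineability

theorem notMem_L_of_pencil {A : Set ℕ} {k : ℕ} (hA : ∀ n ∈ A, 2 ≤ n) (hAk : ∀ n ∈ A, 2 * n ≤ k)
    (hk : 2 ≤ k) {x y : lp (fun _ : ℕ => ℝ) ∞}
    (hxy : ∀ a b : ℝ, a ≠ 0 ∨ b ≠ 0 → a • x + b • y ∈ ⋃ n ∈ A ∪ {k}, L (n : Cardinal)) :
    x ∉ L (k : Cardinal) := by
  have hmem (a b : ℝ) (hab : a ≠ 0 ∨ b ≠ 0) := mem_iUnion_L_iff.1 (hxy a b hab)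
  have hx : (accPoints x).Finite := by simpa using (hmem 1 0 (by simp)).1
  have hy : (accPoints y).Finite := by simpa using (hmem 0 1 (by simp)).1
  obtain ⟨K, hK⟩ := (finite_jointAccPoints hx hy).exists_finset_coe
  have hncard (a b : ℝ) :
      (accPoints (a • x + b • y)).ncard =
        #(K.image (a • (Prod.fst : ℝ × ℝ → ℝ) + b • Prod.snd)) := by
    rw [accPoints_smul_add_smul, ← hK, ← coe_image, Set.ncard_coe_finset]
  have hfst : #(K.image Prod.fst) ≠ k :=
    card_image_ne_of_pencil (g := Prod.snd) hA hAk hk (Set.injOn_id _)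
      fun a b hab => hncard a b ▸ (hmem a b hab).2
  have hxk : (accPoints x).ncard = #(K.image Prod.fst) := by simpa using hncard 1 0
  intro hxL
  rw [L, Set.mem_ofPred_eq, ← Set.cast_ncard hx, Nat.cast_inj] at hxL
  exact hfst (hxk ▸ hxL)

theorem rank_le_one_of_mem_L {A : Set ℕ} {k : ℕ} (hA : ∀ n ∈ A, 2 ≤ n)
    (hAk : ∀ n ∈ A, 2 * n ≤ k) (hk : 2 ≤ k) {V : Submodule ℝ (lp (fun _ : ℕ => ℝ) ∞)}
    (hV : (V : Set (lp (fun _ : ℕ => ℝ) ∞)) ⊆ (⋃ n ∈ A ∪ {k}, L (n : Cardinal)) ∪ {0})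
    {x : lp (fun _ : ℕ => ℝ) ∞} (hxV : x ∈ V) (hx0 : x ≠ 0) (hx : x ∈ L (k : Cardinal)) :
    Module.rank ℝ V ≤ 1 := by
  by_contra! hrank
  obtain ⟨y, hxy⟩ := exists_linearIndependent_pair_of_one_lt_rank hrank
    (x := (⟨x, hxV⟩ : V)) (Subtype.coe_ne_coe.1 hx0)
  rw [LinearIndependent.pair_iff] at hxy
  refine notMem_L_of_pencil hA hAk hk (y := (y : lp (fun _ : ℕ => ℝ) ∞)) (fun a b hab => ?_) hx
  refine (hV (V.add_mem (V.smul_mem a hxV) (V.smul_mem b y.2))).resolve_right fun h0 => ?_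
  have := hxy a b (Subtype.ext h0)
  tauto

theorem isLineable_one {A : Set ℕ} {n : ℕ} (hn : n ∈ A) (hn0 : n ≠ 0) :
    IsLineable ((1 : ℕ) : Cardinal) (⋃ n ∈ A, L (n : Cardinal)) := by
  obtain ⟨x, hx0, hx⟩ := exists_ncard_accPoints_eq hn0
  refine ⟨ℝ ∙ x, by rw [← Module.finrank_eq_rank, finrank_span_singleton hx0], fun y hy => ?_⟩
  obtain ⟨c, rfl⟩ := Submodule.mem_span_singleton.1 hy
  rcases eq_or_ne c 0 with rfl | hc
  · exact Or.inr (zero_smul ℝ x)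
  · left
    rw [mem_iUnion_L_iff, accPoints_smul, Set.ncard_image_of_injective _ (mul_right_injective₀ hc),
      hx]
    exact ⟨(Set.finite_of_ncard_ne_zero (hx.trans_ne hn0)).image _, hn⟩

theorem natCast_le_ell {A : Set ℕ} {m : ℕ}
    (h : IsLineable (m : Cardinal) (⋃ n ∈ A, L (n : Cardinal))) : (m : ℕ∞) ≤ ell A :=
  le_sSup ⟨m, rfl, h⟩

theorem ell_le_iff {A : Set ℕ} {e : ℕ∞} :
    ell A ≤ e ↔ ∀ m : ℕ, IsLineable (m : Cardinal) (⋃ n ∈ A, L (n : Cardinal)) → (m : ℕ∞) ≤ e := by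
  rw [ell, sSup_le_iff]
  constructor
  · exact fun h m hm => h _ ⟨m, rfl, hm⟩
  · rintro h _ ⟨m, rfl, hm⟩
    exact h m hm

theorem ell_mono : Monotone ell := fun _ _ hAB => ell_le_iff.2 fun _ ⟨V, hrank, hV⟩ =>
  natCast_le_ell ⟨V, hrank, hV.trans <|
    Set.union_subset_union_left _ (Set.biUnion_subset_biUnion_left hAB)⟩

end Lineability

end AccLineability

open AccLineability in
theorem mainTheorem7_general {A : Set ℕ} (hA : A.Nonempty) (hmin : ∀ n ∈ A, 2 ≤ n) {k : ℕ}
    (hk : ∀ n ∈ A, 2 * n ≤ k) : ell (A ∪ {k}) = ell A := by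
  obtain ⟨n, hn⟩ := hA
  have hk2 : 2 ≤ k := by linarith [hmin n hn, hk n hn]
  refine le_antisymm (ell_le_iff.2 fun m ⟨V, hrank, hV⟩ => ?_) (ell_mono Set.subset_union_left)
  by_cases hVk : ∃ x ∈ V, x ≠ 0 ∧ x ∈ L (k : Cardinal)
  · obtain ⟨x, hxV, hx0, hx⟩ := hVk
    have hm : m ≤ 1 := by
      exact_mod_cast hrank ▸ rank_le_one_of_mem_L hmin hk hk2 hV hxV hx0 hx
    have hn0 : n ≠ 0 := by linarith [hmin n hn]
    exact (Nat.cast_le.2 hm).trans (natCast_le_ell (isLineable_one hn hn0))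
  · push Not at hVk
    refine natCast_le_ell ⟨V, hrank, fun x hxV => or_iff_not_imp_right.2 fun hx0 => ?_⟩
    have hx := (hV hxV).resolve_right hx0
    rw [Set.biUnion_union, Set.biUnion_singleton] at hx
    exact hx.resolve_right (hVk x hxV hx0)

theorem mainTheorem7 (A : Finset ℕ) (hA : A.Nonempty) (hmin : 2 ≤ A.min' hA)
    (k : ℕ) (hk : 2 * A.max' hA < k) :
    AccLineability.ell ((A : Set ℕ) ∪ {k}) = AccLineability.ell (A : Set ℕ) :=
  mainTheorem7_general hA (fun n hn => hmin.trans (A.min'_le n hn))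
    fun n hn => (Nat.mul_le_mul_left 2 (A.le_max' n hn)).trans hk.le
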